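/- Let $\mathcal R=\mathbb R[c_1,c_2,c_3,d_1,d_2,d_3,e_1,e_2,e_3,f_0]$ be the polynomial ring in the coefficients of the reduced quartic form $$(x^2+y^2+z^2)^2+c_1x^2+c_2y^2+c_3z^2+2d_1yz+2d_2xz+2d_3xy+2e_1x+2e_2y+2e_3z+f_0=0,$$ and put $$C_0=c_1+c_2+c_3,\qquad E_0=e_1^2+e_2^2+e_3^2,\qquad W_1=c_1c_2+c_1c_3+c_2c_3-d_1^2-d_2^2-d_3^2,$$ $$W_2=c_1c_2c_3+2d_1d_2d_3-c_1d_1^2-c_2d_2^2-c_3d_3^2,$$ $$W_4=c_1e_1^2+c_2e_2^2+c_3e_3^2+2d_1e_2e_3+2d_2e_1e_3+2d_3e_1e_2.$$ The ideal $\mathcal I_4^*\subset\mathcal R$ specifying Dupin cyclides of this form is defined by eliminating the coefficients $A_1,A_2,A_3,D,F$ of the canonical form $(x^2+y^2+z^2)^2+A_1x^2+A_2y^2+A_3z^2+Dx+F=0$: let $J\subset\mathcal R[A_1,A_2,A_3,D,F]$ be the ideal generated by (the differences of the two sides of) the relations characterizing Dupin cyclides in canonical form, $$D^2=-(A_2+A_3)(A_1-A_2)(A_1-A_3),\qquad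 4F=A_2^2+A_3^2+A_2A_3-A_1A_2-A_1A_3,$$ and the relations for equivalence of the two forms under orthogonal transformations of $(x,y,z)$, $$A_1+A_2+A_3=C_0,\qquad A_1A_2+A_1A_3+A_2A_3=W_1,\qquad A_1A_2A_3=W_2,$$ $$A_1e_1=c_1e_1+d_3e_2+d_2e_3,\qquad A_1e_2=d_3e_1+c_2e_2+d_1e_3,\qquad A_1e_3=d_2e_1+d_1e_2+c_3e_3,$$ $$D^2=4E_0,\qquad F=f_0;$$ then $\mathcal I_4^*=J\cap\mathcal R$. Let $\sigma_{12}$ and $\sigma_{13}$ be the automorphisms of $\mathcal R$ that exchange the indices $1,2$, respectively $1,3$, of the variables $c_i,d_i,e_i$ and fix $f_0$. **Proposition 3.4.** The ideal $\mathcal I_4^*$ is generated by the following $12$ polynomials: 1. $K_1=(c_3-c_2)e_2e_3+d_1(e_2^2-e_3^2)+(d_2e_2-d_3e_3)e_1$, $\;K_2=\sigma_{12}K_1$, $\;K_3=\sigma_{13}K_1$; 2. $L_1=\big(W_1+4f_0-(c_2+c_3)^2-d_2^2-d_3^2\big)e_1+\big(C_0d_3+c_3d_3-d_1d_2\big)e_2+\big(C_0d_2+c_2d_2-d_1d_3\big)e_3$,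 $\;L_2=\sigma_{12}L_1$, $\;L_3=\sigma_{13}L_1$; 3. $M_1=2(c_1e_1+d_3e_2+d_2e_3)(W_1+4f_0)+e_1(W_2-C_0W_1-4E_0)$, $\;M_2=\sigma_{12}M_1$, $\;M_3=\sigma_{13}M_1$; 4. $N_1=(4W_1+12f_0-3C_0^2)(W_1+4f_0)-2C_0(W_2-C_0W_1-6E_0)-4W_4$, $N_2=4(W_2-C_0W_1-2E_0)(W_1+4f_0)+(C_0^2-4f_0)(W_2+C_0W_1+8C_0f_0-4E_0)$, $N_3=(W_2+C_0W_1+8C_0f_0-4E_0)^2-4(W_1+4f_0)^3$. -/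

import Mathlib

noncomputable section

namespace QuarticDupin

/-- The ten coefficients of the reduced quartic form
`(x² + y² + z²)² + c₁x² + c₂y² + c₃z² + 2d₁yz + 2d₂xz + 2d₃xy + 2e₁x + 2e₂y + 2e₃z + f₀`,
as indeterminates. The indices `1, 2, 3` are the elements `0, 1, 2` of `Fin 3`. -/
inductive Coeff : Type
  | c (i : Fin 3)
  | d (i : Fin 3)
  | e (i : Fin 3)
  | f₀

/-- The five coefficients of the canonical form
`(x² + y² + z²)² + A₁x² + A₂y² + A₃z² + D x + F`, as indeterminates. -/
inductive Canon : Type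
  | A (i : Fin 3)
  | D
  | F

/-- The polynomial ring `ℝ[c₁, c₂, c₃, d₁, d₂, d₃, e₁, e₂, e₃, f₀]`. -/
abbrev R4 : Type := MvPolynomial Coeff ℝ

/-- The polynomial ring in the coefficients of both forms. -/
abbrev R4Ext : Type := MvPolynomial (Coeff ⊕ Canon) ℝ

/-- The inclusion of polynomial rings `R4 ⊆ R4Ext`. -/
def incl : R4 →ₐ[ℝ] R4Ext := MvPolynomial.rename Sum.inl

/-! ### The coefficients as polynomials -/

def c₁ : R4 := MvPolynomial.X (Coeff.c 0)
def c₂ : R4 := MvPolynomial.X (Coeff.c 1)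
def c₃ : R4 := MvPolynomial.X (Coeff.c 2)
def d₁ : R4 := MvPolynomial.X (Coeff.d 0)
def d₂ : R4 := MvPolynomial.X (Coeff.d 1)
def d₃ : R4 := MvPolynomial.X (Coeff.d 2)
def e₁ : R4 := MvPolynomial.X (Coeff.e 0)
def e₂ : R4 := MvPolynomial.X (Coeff.e 1)
def e₃ : R4 := MvPolynomial.X (Coeff.e 2)
def f₀ : R4 := MvPolynomial.X Coeff.f₀

def A₁ : R4Ext := MvPolynomial.X (Sum.inr (Canon.A 0))
def A₂ : R4Ext := MvPolynomial.X (Sum.inr (Canon.A 1))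
def A₃ : R4Ext := MvPolynomial.X (Sum.inr (Canon.A 2))
def D : R4Ext := MvPolynomial.X (Sum.inr Canon.D)
def F : R4Ext := MvPolynomial.X (Sum.inr Canon.F)

/-! ### Abbreviations -/

def C₀ : R4 := c₁ + c₂ + c₃

def E₀ : R4 := e₁ ^ 2 + e₂ ^ 2 + e₃ ^ 2

def W₁ : R4 := c₁ * c₂ + c₁ * c₃ + c₂ * c₃ - d₁ ^ 2 - d₂ ^ 2 - d₃ ^ 2

def W₂ : R4 := c₁ * c₂ * c₃ + 2 * d₁ * d₂ * d₃ - c₁ * d₁ ^ 2 - c₂ * d₂ ^ 2 - c₃ * d₃ ^ 2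

def W₄ : R4 :=
  c₁ * e₁ ^ 2 + c₂ * e₂ ^ 2 + c₃ * e₃ ^ 2
    + 2 * d₁ * e₂ * e₃ + 2 * d₂ * e₁ * e₃ + 2 * d₃ * e₁ * e₂

/-! ### The elimination ideal -/

/-- The relations between the coefficients of the canonical form that hold for quartic Dupin
cyclides, as polynomials that have to vanish. -/
def canonicalRelations : Set R4Ext :=
  {D ^ 2 - -(A₂ + A₃) * (A₁ - A₂) * (A₁ - A₃),
   4 * F - (A₂ ^ 2 + A₃ ^ 2 + A₂ * A₃ - A₁ * A₂ - A₁ * A₃)}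

/-- The relations between the coefficients of the reduced form and those of the canonical form
that express that the two are related by an orthogonal transformation of `(x, y, z)`, as
polynomials that have to vanish. -/
def orthogonalRelations : Set R4Ext :=
  {A₁ + A₂ + A₃ - incl (c₁ + c₂ + c₃),
   A₁ * A₂ + A₁ * A₃ + A₂ * A₃
     - incl (c₁ * c₂ + c₁ * c₃ + c₂ * c₃ - d₁ ^ 2 - d₂ ^ 2 - d₃ ^ 2),
   A₁ * A₂ * A₃
     - incl (c₁ * c₂ * c₃ + 2 * d₁ * d₂ * d₃ - c₁ * d₁ ^ 2 - c₂ * d₂ ^ 2 - c₃ * d₃ ^ 2),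
   A₁ * incl e₁ - incl (c₁ * e₁ + d₃ * e₂ + d₂ * e₃),
   A₁ * incl e₂ - incl (d₃ * e₁ + c₂ * e₂ + d₁ * e₃),
   A₁ * incl e₃ - incl (d₂ * e₁ + d₁ * e₂ + c₃ * e₃),
   D ^ 2 - 4 * incl E₀,
   F - incl f₀}

/-- The ideal `I₄*` of `R4`: eliminate `A₁, A₂, A₃, D, F` from the ideal of `R4Ext` generated by
all the relations, that is, intersect that ideal with `R4`. -/
def I4star : Ideal R4 :=
  (Ideal.span (canonicalRelations ∪ orthogonalRelations)).comap incl

/-! ### The permutations of the coefficients -/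

/-- Apply a permutation of the indices `1, 2, 3` to the coefficients. -/
def permCoeff (π : Equiv.Perm (Fin 3)) : Coeff → Coeff
  | Coeff.c i => Coeff.c (π i)
  | Coeff.d i => Coeff.d (π i)
  | Coeff.e i => Coeff.e (π i)
  | Coeff.f₀ => Coeff.f₀

/-- Permute the indices `1` and `2`. -/
def σ₁₂ : R4 →ₐ[ℝ] R4 := MvPolynomial.rename (permCoeff (Equiv.swap 0 1))

/-- Permute the indices `1` and `3`. -/
def σ₁₃ : R4 →ₐ[ℝ] R4 := MvPolynomial.rename (permCoeff (Equiv.swap 0 2))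

/-! ### The twelve polynomials -/

def K₁ : R4 := (c₃ - c₂) * e₂ * e₃ + d₁ * (e₂ ^ 2 - e₃ ^ 2) + (d₂ * e₂ - d₃ * e₃) * e₁
def K₂ : R4 := σ₁₂ K₁
def K₃ : R4 := σ₁₃ K₁

def L₁ : R4 :=
  (W₁ + 4 * f₀ - (c₂ + c₃) ^ 2 - d₂ ^ 2 - d₃ ^ 2) * e₁
    + (C₀ * d₃ + c₃ * d₃ - d₁ * d₂) * e₂ + (C₀ * d₂ + c₂ * d₂ - d₁ * d₃) * e₃
def L₂ : R4 := σ₁₂ L₁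
def L₃ : R4 := σ₁₃ L₁

def M₁ : R4 :=
  2 * (c₁ * e₁ + d₃ * e₂ + d₂ * e₃) * (W₁ + 4 * f₀) + e₁ * (W₂ - C₀ * W₁ - 4 * E₀)
def M₂ : R4 := σ₁₂ M₁
def M₃ : R4 := σ₁₃ M₁

def N₁ : R4 :=
  (4 * W₁ + 12 * f₀ - 3 * C₀ ^ 2) * (W₁ + 4 * f₀) - 2 * C₀ * (W₂ - C₀ * W₁ - 6 * E₀) - 4 * W₄

def N₂ : R4 :=
  4 * (W₂ - C₀ * W₁ - 2 * E₀) * (W₁ + 4 * f₀)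
    + (C₀ ^ 2 - 4 * f₀) * (W₂ + C₀ * W₁ + 8 * C₀ * f₀ - 4 * E₀)

def N₃ : R4 := (W₂ + C₀ * W₁ + 8 * C₀ * f₀ - 4 * E₀) ^ 2 - 4 * (W₁ + 4 * f₀) ^ 3

end QuarticDupin

end

noncomputable section

namespace QuarticDupin

open MvPolynomial

/-! ### Koszul relations of a regular sequence -/

/-! Everything is expressed through `B = A₂ + A₃`. The relations imply `A₁ = C₀ - B`, `B² = p₀` and
six linear equations `fⱼ B = gⱼ` with `f = (e₁, e₂, e₃, u₀, 2p₀, q₀)`, `g = (v₁, v₂, v₃, t₀, q₀,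
2p₀²)`; the twelve polynomials follow from these (`dupinIdeal_le_ker`). Conversely, given such a
`B`, the elements `A₂` and `D` are roots of monic quadratics. Adjoining them gives free extensions,
so their elimination adds no condition (`I4star_le_ker`).

It remains to eliminate `B` from an ideal of `R4[√p₀] = R4 ⊕ R4·B`. For an element of that ideal
lying in `R4`, the vanishing of the `B`-part is a syzygy of `f`, up to multiples of the generators
`L` and `N₁`. Since `f` is a regular sequence (`seqF_regular`), its syzygies are Koszul, and the
constant part becomes a combination of the minors `fᵢ gⱼ - fⱼ gᵢ`, which lie in the ideal of the
twelve polynomials (`koszul_mem`). -/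

theorem sum_mul_mem_of_regular {R : Type*} [CommRing R] (I : Ideal R) (f g : ℕ → R) (n : ℕ)
    (hfg : ∀ j < n, ∀ i < j, f i * g j - f j * g i ∈ I)
    (hreg : ∀ i < n, ∀ x, x * f i ∈ Ideal.span (f '' (Finset.range i : Set ℕ)) →
      x ∈ Ideal.span (f '' (Finset.range i : Set ℕ)))
    (x : ℕ → R) (hx : ∑ i ∈ Finset.range n, x i * f i = 0) :
    ∑ i ∈ Finset.range n, x i * g i ∈ I := by
  induction n generalizing x with
  | zero => simp
  | succ n ih =>
    rw [Finset.sum_range_succ] at hx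
    -- By regularity the last coefficient is a combination `∑ yᵢ fᵢ` of earlier terms. Subtracting
    -- the matching Koszul syzygies leaves a shorter one.
    have hmem : x n * f n ∈ Ideal.span (f '' (Finset.range n : Set ℕ)) := by
      rw [eq_neg_of_add_eq_zero_right hx]
      exact neg_mem (Ideal.sum_mem _ fun i hi =>
        Ideal.mul_mem_left _ _ (Ideal.subset_span ⟨i, hi, rfl⟩))
    obtain ⟨y, hy⟩ := (Submodule.mem_span_image_finset_iff_exists_fun' R).1
      (hreg n n.lt_succ_self _ hmem)
    simp only [smul_eq_mul] at hy
    have key := ih (fun j hj => hfg j (hj.trans n.lt_succ_self))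
      (fun i hi => hreg i (hi.trans n.lt_succ_self)) (fun i => x i + y i * f n) (by
        rw [← hx, ← hy, Finset.sum_mul, ← Finset.sum_add_distrib]
        exact Finset.sum_congr rfl fun i _ => by ring)
    have hsum : ∑ i ∈ Finset.range (n + 1), x i * g i
        = ∑ i ∈ Finset.range n, (x i + y i * f n) * g i
          + ∑ i ∈ Finset.range n, y i * (f i * g n - f n * g i) := by
      rw [Finset.sum_range_succ, ← hy, Finset.sum_mul, ← Finset.sum_add_distrib,
        ← Finset.sum_add_distrib]
      exact Finset.sum_congr rfl fun i _ => by ring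
    rw [hsum]
    exact add_mem key (Ideal.sum_mem _ fun i hi => Ideal.mul_mem_left _ _
      (hfg n n.lt_succ_self i (Finset.mem_range.1 hi)))

/-! ### The relations satisfied by `A₂ + A₃` -/

/-- With `B = A₂ + A₃`, the relations give `B² = p₀`, `2 p₀ B = q₀`, `u₀ B = t₀` and `eᵢ B = vᵢ`.
Here `v = V e`, where `V` is `C₀` times the identity minus the symmetric matrix of the `cᵢ`, `dᵢ`.
-/
def p₀ : R4 := W₁ + 4 * f₀
def q₀ : R4 := W₂ + C₀ * W₁ + 8 * C₀ * f₀ - 4 * E₀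
def u₀ : R4 := C₀ ^ 2 - 4 * f₀
def t₀ : R4 := 2 * C₀ * W₁ - 2 * W₂ + 4 * E₀
def v₁ : R4 := (c₂ + c₃) * e₁ - d₃ * e₂ - d₂ * e₃
def v₂ : R4 := -d₃ * e₁ + (c₁ + c₃) * e₂ - d₁ * e₃
def v₃ : R4 := -d₂ * e₁ - d₁ * e₂ + (c₁ + c₂) * e₃

/-- The ideal generated by the twelve polynomials. -/
def dupinIdeal : Ideal R4 := Ideal.span {K₁, K₂, K₃, L₁, L₂, L₃, M₁, M₂, M₃, N₁, N₂, N₃}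

theorem K₁_eq : K₁ = v₂ * e₃ - e₂ * v₃ := by
  simp only [K₁, v₂, v₃]; ring

theorem K₂_eq : K₂ = v₁ * e₃ - e₁ * v₃ := by
  have : K₂ = (c₃ - c₁) * e₁ * e₃ + d₂ * (e₁ ^ 2 - e₃ ^ 2) + (d₁ * e₁ - d₃ * e₃) * e₂ := by
    simp [K₂, K₁, σ₁₂, permCoeff, c₁, c₂, c₃, d₁, d₂, d₃, e₁, e₂, e₃, Equiv.swap_apply_def]
  rw [this, v₁, v₃]; ring

theorem K₃_eq : K₃ = v₂ * e₁ - e₂ * v₁ := by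
  have : K₃ = (c₁ - c₂) * e₂ * e₁ + d₃ * (e₂ ^ 2 - e₁ ^ 2) + (d₂ * e₂ - d₁ * e₁) * e₃ := by
    simp [K₃, K₁, σ₁₃, permCoeff, c₁, c₂, c₃, d₁, d₂, d₃, e₁, e₂, e₃, Equiv.swap_apply_def]
  rw [this, v₁, v₂]; ring

theorem L₁_eq : L₁ = p₀ * e₁ - ((c₂ + c₃) * v₁ - d₃ * v₂ - d₂ * v₃) := by
  simp only [L₁, p₀, v₁, v₂, v₃, C₀]; ring

theorem L₂_eq : L₂ = p₀ * e₂ - (-d₃ * v₁ + (c₁ + c₃) * v₂ - d₁ * v₃) := by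
  simp only [L₂, L₁, p₀, W₁, C₀, v₁, v₂, v₃]
  simp [σ₁₂, permCoeff, map_ofNat, c₁, c₂, c₃, d₁, d₂, d₃, e₁, e₂, e₃, f₀, Equiv.swap_apply_def]
  ring

theorem L₃_eq : L₃ = p₀ * e₃ - (-d₂ * v₁ - d₁ * v₂ + (c₁ + c₂) * v₃) := by
  simp only [L₃, L₁, p₀, W₁, C₀, v₁, v₂, v₃]
  simp [σ₁₃, permCoeff, map_ofNat, c₁, c₂, c₃, d₁, d₂, d₃, e₁, e₂, e₃, f₀, Equiv.swap_apply_def]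
  ring

theorem M₁_eq : M₁ = q₀ * e₁ - 2 * p₀ * v₁ := by
  simp only [M₁, p₀, q₀, v₁, C₀]; ring

theorem M₂_eq : M₂ = q₀ * e₂ - 2 * p₀ * v₂ := by
  simp only [M₂, M₁, p₀, q₀, W₁, W₂, E₀, C₀, v₂]
  simp [σ₁₂, permCoeff, map_ofNat, c₁, c₂, c₃, d₁, d₂, d₃, e₁, e₂, e₃, f₀, Equiv.swap_apply_def]
  ring

theorem M₃_eq : M₃ = q₀ * e₃ - 2 * p₀ * v₃ := by
  simp only [M₃, M₁, p₀, q₀, W₁, W₂, E₀, C₀, v₃]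
  simp [σ₁₃, permCoeff, map_ofNat, c₁, c₂, c₃, d₁, d₂, d₃, e₁, e₂, e₃, f₀, Equiv.swap_apply_def]
  ring

theorem N₁_eq :
    N₁ = 4 * p₀ ^ 2 + u₀ * p₀ - 2 * C₀ * q₀ + 4 * (e₁ * v₁ + e₂ * v₂ + e₃ * v₃) := by
  simp only [N₁, p₀, q₀, u₀, W₁, W₂, W₄, E₀, C₀, v₁, v₂, v₃]; ring

theorem N₂_eq : N₂ = u₀ * q₀ - 2 * p₀ * t₀ := by
  simp only [N₂, p₀, q₀, u₀, t₀]; ring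

theorem N₃_eq : N₃ = q₀ ^ 2 - 4 * p₀ ^ 3 := by
  simp only [N₃, p₀, q₀]

theorem t₀_eq : t₀ = 4 * C₀ * p₀ - 4 * (e₁ * e₁ + e₂ * e₂ + e₃ * e₃) - 2 * q₀ := by
  simp only [p₀, q₀, t₀, E₀]; ring

/-- `K`, `M` and `N₂` are 2×2 minors of the linear equations for `B`. Multiplying `eᵢ B = vᵢ` and
`u₀ B = t₀` by `B` and using `B² = p₀` gives `L` and `N₁`; squaring `2 p₀ B = q₀` gives `N₃`. -/
theorem dupinIdeal_le_ker {S : Type*} [CommRing S] (φ : R4 →+* S) (B : S)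
    (hp : B ^ 2 = φ p₀) (hq : 2 * φ p₀ * B = φ q₀) (hu : φ u₀ * B = φ t₀)
    (h₁ : φ e₁ * B = φ v₁) (h₂ : φ e₂ * B = φ v₂) (h₃ : φ e₃ * B = φ v₃) :
    dupinIdeal ≤ RingHom.ker φ := by
  have hv₁ := congrArg φ v₁.eq_1
  have hv₂ := congrArg φ v₂.eq_1
  have hv₃ := congrArg φ v₃.eq_1
  have ht := congrArg φ t₀_eq
  simp only [map_add, map_sub, map_neg, map_mul, map_ofNat] at hv₁ hv₂ hv₃ ht
  rw [dupinIdeal, Ideal.span_le]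
  rintro x (rfl | rfl | rfl | rfl | rfl | rfl | rfl | rfl | rfl | rfl | rfl | rfl) <;>
  simp only [SetLike.mem_coe, RingHom.mem_ker, K₁_eq, K₂_eq, K₃_eq, L₁_eq, L₂_eq, L₃_eq, M₁_eq,
    M₂_eq, M₃_eq, N₁_eq, N₂_eq, N₃_eq, map_add, map_sub, map_neg, map_mul, map_pow, map_ofNat]
  · linear_combination φ e₂ * h₃ - φ e₃ * h₂
  · linear_combination φ e₁ * h₃ - φ e₃ * h₁
  · linear_combination φ e₂ * h₁ - φ e₁ * h₂
  · linear_combination -φ e₁ * hp + B * h₁ + B * hv₁ + (φ c₂ + φ c₃) * h₁ - φ d₃ * h₂ - φ d₂ * h₃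
  · linear_combination -φ e₂ * hp + B * h₂ + B * hv₂ - φ d₃ * h₁ + (φ c₁ + φ c₃) * h₂ - φ d₁ * h₃
  · linear_combination -φ e₃ * hp + B * h₃ + B * hv₃ - φ d₂ * h₁ - φ d₁ * h₂ + (φ c₁ + φ c₂) * h₃
  · linear_combination -φ e₁ * hq + 2 * φ p₀ * h₁
  · linear_combination -φ e₂ * hq + 2 * φ p₀ * h₂
  · linear_combination -φ e₃ * hq + 2 * φ p₀ * h₃
  · linear_combination 2 * B * hq + (-4 * φ p₀ - φ u₀) * hp + B * hu + B * ht
      + 2 * φ C₀ * hq - 4 * (φ e₁ * h₁ + φ e₂ * h₂ + φ e₃ * h₃)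
  · linear_combination -φ u₀ * hq + 2 * φ p₀ * hu
  · linear_combination -(φ q₀ + 2 * φ p₀ * B) * hq + 4 * φ p₀ ^ 2 * hp

theorem dupinIdeal_le_I4star : dupinIdeal ≤ I4star := by
  set J := Ideal.span (canonicalRelations ∪ orthogonalRelations) with hJ
  let π := (Ideal.Quotient.mk J).comp (incl : R4 →+* R4Ext)
  have hrel : ∀ x ∈ canonicalRelations ∪ orthogonalRelations, Ideal.Quotient.mk J x = 0 :=
    fun x hx => Ideal.Quotient.eq_zero_iff_mem.2 (Ideal.subset_span hx)
  have hker : I4star = RingHom.ker π := by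
    ext x
    simp [I4star, RingHom.mem_ker, π, Ideal.Quotient.eq_zero_iff_mem, ← hJ]
  have hπ : ∀ x, Ideal.Quotient.mk J (incl x) = π x := fun x => rfl
  rw [hker]
  simp only [canonicalRelations, orthogonalRelations, Set.mem_union, Set.mem_insert_iff,
    Set.mem_singleton_iff, or_imp, forall_and, forall_eq, map_add, map_sub, map_neg, map_mul,
    map_pow, map_ofNat, hπ] at hrel
  obtain ⟨⟨g₁, g₂⟩, k₁, k₂, k₃, k₄, k₅, k₆, k₇, k₈⟩ := hrel
  generalize Ideal.Quotient.mk J A₁ = a₁ at *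
  generalize Ideal.Quotient.mk J A₂ = a₂ at *
  generalize Ideal.Quotient.mk J A₃ = a₃ at *
  have hC : π C₀ = a₁ + a₂ + a₃ := by
    simp only [C₀, map_add]; linear_combination -k₁
  have hW₁ : π W₁ = a₁ * a₂ + a₁ * a₃ + a₂ * a₃ := by
    simp only [W₁, map_add, map_sub, map_mul, map_pow]; linear_combination -k₂
  have hW₂ : π W₂ = a₁ * a₂ * a₃ := by
    simp only [W₂, map_add, map_sub, map_mul, map_pow, map_ofNat]; linear_combination -k₃
  have hE : 4 * π E₀ = -(a₂ + a₃) * (a₁ - a₂) * (a₁ - a₃) := by linear_combination g₁ - k₇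
  have hf : 4 * π f₀ = a₂ ^ 2 + a₃ ^ 2 + a₂ * a₃ - a₁ * a₂ - a₁ * a₃ := by
    linear_combination g₂ - 4 * k₈
  apply dupinIdeal_le_ker π (a₂ + a₃)
  · simp only [p₀, map_add, map_mul, map_ofNat, hW₁]
    linear_combination -hf
  · simp only [p₀, q₀, map_add, map_sub, map_mul, map_ofNat, hC, hW₁, hW₂]
    linear_combination -2 * a₁ * hf + hE
  · simp only [u₀, t₀, map_add, map_sub, map_mul, map_pow, map_ofNat, hC, hW₁, hW₂]
    linear_combination -(a₂ + a₃) * hf - hE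
  · simp only [v₁, map_add, map_sub, map_mul]
    linear_combination π e₁ * k₁ - k₄
  · simp only [v₂, map_add, map_sub, map_neg, map_mul]
    linear_combination π e₂ * k₁ - k₅
  · simp only [v₃, map_add, map_sub, map_neg, map_mul]
    linear_combination π e₃ * k₁ - k₆

/-! ### Regularity of the sequence `e₁, e₂, e₃, u₀, 2 p₀, q₀` -/

theorem sub_aeval_mem {σ : Type*} (I : Ideal (MvPolynomial σ ℝ)) (g : σ → MvPolynomial σ ℝ)
    (hg : ∀ i, X i - g i ∈ I) (p : MvPolynomial σ ℝ) : p - aeval g p ∈ I := by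
  rw [← Ideal.Quotient.eq_zero_iff_mem, map_sub, sub_eq_zero]
  have : Ideal.Quotient.mkₐ ℝ I = (Ideal.Quotient.mkₐ ℝ I).comp (aeval g) := by
    ext i
    simpa [sub_eq_zero] using Ideal.Quotient.eq_zero_iff_mem.2 (hg i)
  exact DFunLike.congr_fun this p

/-- The span is the kernel of a substitution into a polynomial ring. It is therefore prime, and
regularity of the next element reduces to its image being nonzero. -/
theorem mem_iff_aeval_eq_zero {σ : Type*} (s : Set (MvPolynomial σ ℝ))
    (g : σ → MvPolynomial σ ℝ) (hg : ∀ i, X i - g i ∈ Ideal.span s)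
    (hs : ∀ x ∈ s, aeval g x = 0) (p : MvPolynomial σ ℝ) :
    p ∈ Ideal.span s ↔ aeval g p = 0 := by
  refine ⟨fun h => ?_, fun h => by
    simpa only [h, sub_zero] using sub_aeval_mem _ g hg p⟩
  have : Ideal.span s ≤ RingHom.ker (aeval g : MvPolynomial σ ℝ →ₐ[ℝ] _) := Ideal.span_le.2 hs
  exact this h

theorem mem_span_of_mul_mem {σ : Type*} (s : Set (MvPolynomial σ ℝ))
    (g : σ → MvPolynomial σ ℝ) (hg : ∀ i, X i - g i ∈ Ideal.span s)
    (hs : ∀ x ∈ s, aeval g x = 0) {f : MvPolynomial σ ℝ} (hf : aeval g f ≠ 0)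
    (x : MvPolynomial σ ℝ) (hx : x * f ∈ Ideal.span s) : x ∈ Ideal.span s := by
  rw [mem_iff_aeval_eq_zero s g hg hs] at hx ⊢
  rw [map_mul] at hx
  exact (mul_eq_zero.1 hx).resolve_right hf

theorem aeval_ne_zero_of_eval {σ : Type*} {g : σ → MvPolynomial σ ℝ} {f : MvPolynomial σ ℝ}
    (a : σ → ℝ) (h : aeval (fun i => eval a (g i)) f ≠ (0 : ℝ)) : aeval g f ≠ 0 := by
  intro h0
  apply h
  have := congrArg (eval a) h0
  rw [map_zero, ← coe_aeval_eq_eval, RingHom.coe_coe, comp_aeval_apply] at this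
  exact this

/-- The substitution that sets `e₁, …, eₖ` to zero. -/
def killE (k : ℕ) : Coeff → R4
  | Coeff.e i => if i.val < k then 0 else X (Coeff.e i)
  | x => X x

/-- The substitution `e₁ = e₂ = e₃ = 0`, `f₀ = C₀² / 4`. -/
def killU : Coeff → R4
  | Coeff.e _ => 0
  | Coeff.f₀ => C (1 / 4) * C₀ ^ 2
  | x => X x

/-- A point at which `e₁`, `e₂`, `e₃` and `u₀` do not vanish. -/
def point : Coeff → ℝ
  | Coeff.c _ => 0
  | Coeff.d _ => 0
  | _ => 1

/-- The regular sequence. -/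
def seqF : ℕ → R4
  | 0 => e₁
  | 1 => e₂
  | 2 => e₃
  | 3 => u₀
  | 4 => 2 * p₀
  | _ => q₀

/-- The elements that `seqF` becomes after multiplication by `A₂ + A₃`. -/
def seqG : ℕ → R4
  | 0 => v₁
  | 1 => v₂
  | 2 => v₃
  | 3 => t₀
  | 4 => q₀
  | _ => 2 * p₀ ^ 2

theorem four_mul_C : (4 : R4) * C (1 / 4) = 1 := by
  rw [show (4 : R4) = C 4 from (map_ofNat C 4).symm, ← C_mul]; norm_num

/-- The quadratic form to which `p₀` specializes. -/
theorem aeval_killU_p₀ : aeval killU p₀ = W₁ + C₀ ^ 2 := by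
  simp only [p₀, W₁, c₁, c₂, c₃, d₁, d₂, d₃, f₀, map_add, map_sub, map_mul, map_pow, map_ofNat,
    aeval_X, killU]
  linear_combination C₀ ^ 2 * four_mul_C

theorem aeval_killU_u₀ : aeval killU u₀ = 0 := by
  simp only [u₀, C₀, c₁, c₂, c₃, f₀, map_add, map_sub, map_mul, map_pow, map_ofNat,
    aeval_X, killU]
  linear_combination -(X (Coeff.c 0) + X (Coeff.c 1) + X (Coeff.c 2)) ^ 2 * four_mul_C

/-- A linear change of coordinates after which `W₁ + C₀²` is linear in `c₁`. -/
def shear : Coeff → R4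
  | Coeff.c i => ![c₁ - c₂ - 2 * d₁, c₂ - c₃ + 2 * d₁, c₃] i
  | Coeff.d i => ![d₁ + c₁, d₂, d₃] i
  | x => X x

def shearInv : Coeff → R4
  | Coeff.c i => ![c₁ + c₂ + c₃, c₂ + c₃ - 2 * (d₁ - (c₁ + c₂ + c₃)), c₃] i
  | Coeff.d i => ![d₁ - (c₁ + c₂ + c₃), d₂, d₃] i
  | x => X x

def shearEquiv : R4 ≃ₐ[ℝ] R4 :=
  AlgEquiv.ofAlgHom (aeval shear) (aeval shearInv)
    (by
      refine algHom_ext fun i => ?_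
      rcases i with i | i | i | _ <;> try fin_cases i
      all_goals simp [shear, shearInv, map_ofNat, c₁, c₂, c₃, d₁, d₂, d₃]
      all_goals ring)
    (by
      refine algHom_ext fun i => ?_
      rcases i with i | i | i | _ <;> try fin_cases i
      all_goals simp [shear, shearInv, map_ofNat, c₁, c₂, c₃, d₁, d₂, d₃]
      all_goals ring)

/-- The vector `c₁ = d₁ = 1`, all else zero, is isotropic for this quadratic form. The shear moves
it onto the `c₁`-axis and turns the form into `c₂ c₁ + g`, with `g` free of `c₁` and not divisible
by `c₂`. -/
theorem irreducible_W₁_add_sq : Irreducible (W₁ + C₀ ^ 2) := by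
  rw [← MulEquiv.irreducible_iff shearEquiv]
  have : shearEquiv (W₁ + C₀ ^ 2) = X (Coeff.c 1) * X (Coeff.c 0) +
      -((c₂ - c₃ + 2 * d₁) ^ 2 + (c₂ - c₃ + 2 * d₁) * c₃ + c₃ ^ 2 + d₁ ^ 2 + d₂ ^ 2 + d₃ ^ 2) := by
    simp [shearEquiv, W₁, C₀, shear, c₁, c₂, c₃, d₁, d₂, d₃]
    ring
  rw [this]
  have hs : ∀ p ∈ supported ℝ ({Coeff.c 0}ᶜ : Set Coeff), Coeff.c 0 ∉ p.vars := by
    intro p hp h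
    exact mem_supported.1 hp h rfl
  have h1 : c₂ ∈ supported ℝ ({Coeff.c 0}ᶜ : Set Coeff) := by simp [c₂, X_mem_supported]
  have h2 : c₃ ∈ supported ℝ ({Coeff.c 0}ᶜ : Set Coeff) := by simp [c₃, X_mem_supported]
  have h3 : d₁ ∈ supported ℝ ({Coeff.c 0}ᶜ : Set Coeff) := by simp [d₁, X_mem_supported]
  have h4 : d₂ ∈ supported ℝ ({Coeff.c 0}ᶜ : Set Coeff) := by simp [d₂, X_mem_supported]
  have h5 : d₃ ∈ supported ℝ ({Coeff.c 0}ᶜ : Set Coeff) := by simp [d₃, X_mem_supported]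
  have h6 : c₂ - c₃ + 2 * d₁ ∈ supported ℝ ({Coeff.c 0}ᶜ : Set Coeff) :=
    add_mem (sub_mem h1 h2) (mul_mem (ofNat_mem _ 2) h3)
  refine irreducible_mul_X_add _ _ _ (X_ne_zero _) (hs _ h1) (hs _ (neg_mem ?_)) ?_
  · exact add_mem (add_mem (add_mem (add_mem (add_mem (pow_mem h6 2) (mul_mem h6 h2))
      (pow_mem h2 2)) (pow_mem h3 2)) (pow_mem h4 2)) (pow_mem h5 2)
  · rw [(X_prime (R := ℝ)).irreducible.isRelPrime_iff_not_dvd]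
    rintro ⟨z, hz⟩
    -- At this point `c₂` vanishes while the other term equals `-7`.
    have := congrArg (eval (fun x => match x with | Coeff.d _ => (1 : ℝ) | _ => 0)) hz
    norm_num [c₂, c₃, d₁, d₂, d₃] at this

theorem not_dvd_aeval_killU_q₀ : ¬ W₁ + C₀ ^ 2 ∣ aeval killU q₀ := by
  rintro ⟨z, hz⟩
  -- At `cᵢ = 1`, `dᵢ = 2` the form is `-9 + 9 = 0`, while the specialized `q₀` is `5 - 27 + 54 =
  -- 32`.
  have := congrArg (eval (fun x => match x with
    | Coeff.c _ => (1 : ℝ)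
    | Coeff.d _ => 2
    | _ => 0)) hz
  norm_num [q₀, killU, map_ofNat, W₁, W₂, C₀, E₀, c₁, c₂, c₃, d₁, d₂, d₃, e₁, e₂, e₃, f₀] at this

theorem seqF_regular (n : ℕ) (hn : n < 6) (x : R4)
    (hx : x * seqF n ∈ Ideal.span (seqF '' (Finset.range n : Set ℕ))) :
    x ∈ Ideal.span (seqF '' (Finset.range n : Set ℕ)) := by
  have hmem : ∀ i < n, seqF i ∈ Ideal.span (seqF '' (Finset.range n : Set ℕ)) := fun i hi =>
    Ideal.subset_span ⟨i, by simpa using hi, rfl⟩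
  have hkill : n ≤ 3 → ∀ i, X i - killE n i ∈ Ideal.span (seqF '' (Finset.range n : Set ℕ)) := by
    intro hn3 i
    rcases i with i | i | i | _ <;> simp only [killE, sub_self, zero_mem]
    split_ifs with hi
    · rw [sub_zero]
      have := hmem i hi
      fin_cases i <;> exact this
    · simp
  have hkillU : 3 < n → ∀ i, X i - killU i ∈ Ideal.span (seqF '' (Finset.range n : Set ℕ)) := by
    intro hn3 i
    rcases i with i | i | i | _ <;> simp only [killU, sub_self, zero_mem, sub_zero]
    · have := hmem i (by omega)
      fin_cases i <;> exact this
    · have : X Coeff.f₀ - C (1 / 4) * C₀ ^ 2 = -C (1 / 4) * seqF 3 := by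
        simp only [seqF, u₀, f₀]
        linear_combination -X Coeff.f₀ * four_mul_C
      rw [this]
      exact Ideal.mul_mem_left _ (-C (1 / 4)) (hmem 3 hn3)
  interval_cases n
  · refine mem_span_of_mul_mem _ (killE 0) (hkill (by norm_num)) (by simp) ?_ x hx
    exact aeval_ne_zero_of_eval point (by simp [seqF, killE, point, e₁])
  · refine mem_span_of_mul_mem _ (killE 1) (hkill (by norm_num)) (by simp [seqF, killE, e₁]) ?_ x hx
    exact aeval_ne_zero_of_eval point (by simp [seqF, killE, point, e₂])
  · refine mem_span_of_mul_mem _ (killE 2) (hkill (by norm_num)) ?_ ?_ x hx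
    · rintro _ ⟨i, hi, rfl⟩
      have hi : i < 2 := by simpa using hi
      interval_cases i <;> simp [seqF, killE, e₁, e₂]
    exact aeval_ne_zero_of_eval point (by simp [seqF, killE, point, e₃])
  · refine mem_span_of_mul_mem _ (killE 3) (hkill (by norm_num)) ?_ ?_ x hx
    · rintro _ ⟨i, hi, rfl⟩
      have hi : i < 3 := by simpa using hi
      interval_cases i <;> simp [seqF, killE, e₁, e₂, e₃]
    exact aeval_ne_zero_of_eval point
      (by simp [seqF, killE, point, map_ofNat, u₀, C₀, c₁, c₂, c₃, f₀])
  · refine mem_span_of_mul_mem _ killU (hkillU (by norm_num)) ?_ ?_ x hx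
    · rintro _ ⟨i, hi, rfl⟩
      have hi : i < 4 := by simpa using hi
      interval_cases i
      · simp [seqF, killU, e₁]
      · simp [seqF, killU, e₂]
      · simp [seqF, killU, e₃]
      · exact aeval_killU_u₀
    simp only [seqF, map_mul, map_ofNat, aeval_killU_p₀]
    exact mul_ne_zero two_ne_zero irreducible_W₁_add_sq.ne_zero
  -- Modulo the first five elements the ring is no longer a polynomial ring: after `killU` the prime
  -- `W₁ + C₀²` must still be divided out.
  · have hsub := sub_aeval_mem _ killU (hkillU (by norm_num)) x
    have hle : Ideal.span (seqF '' (Finset.range 5 : Set ℕ)) ≤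
        (Ideal.span {W₁ + C₀ ^ 2}).comap (aeval killU : R4 →ₐ[ℝ] R4) := by
      rw [Ideal.span_le]
      rintro _ ⟨i, hi, rfl⟩
      have hi : i < 5 := by simpa using hi
      interval_cases i
      · simp [seqF, killU, e₁]
      · simp [seqF, killU, e₂]
      · simp [seqF, killU, e₃]
      · simp only [seqF, SetLike.mem_coe, Ideal.mem_comap, aeval_killU_u₀, zero_mem]
      · simp only [seqF, SetLike.mem_coe, Ideal.mem_comap, map_mul, aeval_killU_p₀]
        exact Ideal.mul_mem_left _ _ (Ideal.mem_span_singleton_self _)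
    have hdvd := Ideal.mem_span_singleton.1 (hle hx)
    rw [map_mul] at hdvd
    obtain ⟨y, hy⟩ := (irreducible_W₁_add_sq.prime.dvd_or_dvd hdvd).resolve_right
      not_dvd_aeval_killU_q₀
    have hp : W₁ + C₀ ^ 2 ∈ Ideal.span (seqF '' (Finset.range 5 : Set ℕ)) := by
      have h : W₁ + C₀ ^ 2 = C (1 / 4) * 2 * seqF 4 + seqF 3 := by
        simp only [seqF, p₀, u₀]
        linear_combination -(W₁ + 4 * f₀) * four_mul_C
      rw [h]
      exact add_mem (Ideal.mul_mem_left _ _ (hmem 4 (by norm_num))) (hmem 3 (by norm_num))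
    rw [hy] at hsub
    simpa using add_mem hsub (Ideal.mul_mem_right y _ hp)

/-! ### The Koszul relations lie in the ideal of the twelve polynomials -/

theorem generators_eq_zero {S : Type*} [CommRing S] (φ : R4 →+* S)
    (h : dupinIdeal ≤ RingHom.ker φ) :
    (φ K₁ = 0 ∧ φ K₂ = 0 ∧ φ K₃ = 0) ∧ (φ L₁ = 0 ∧ φ L₂ = 0 ∧ φ L₃ = 0) ∧
      (φ M₁ = 0 ∧ φ M₂ = 0 ∧ φ M₃ = 0) ∧ φ N₁ = 0 ∧ φ N₂ = 0 ∧ φ N₃ = 0 := by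
  rw [dupinIdeal, Ideal.span_le] at h
  simp only [Set.insert_subset_iff, Set.singleton_subset_iff, SetLike.mem_coe,
    RingHom.mem_ker] at h
  obtain ⟨k₁, k₂, k₃, l₁, l₂, l₃, m₁, m₂, m₃, n₁, n₂, n₃⟩ := h
  exact ⟨⟨k₁, k₂, k₃⟩, ⟨l₁, l₂, l₃⟩, ⟨m₁, m₂, m₃⟩, n₁, n₂, n₃⟩

theorem mem_dupinIdeal_iff (x : R4) : x ∈ dupinIdeal ↔ Ideal.Quotient.mk dupinIdeal x = 0 :=
  Ideal.Quotient.eq_zero_iff_mem.symm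

theorem koszul_mem (j : ℕ) (hj : j < 6) (i : ℕ) (hi : i < j) :
    seqF i * seqG j - seqF j * seqG i ∈ dupinIdeal := by
  rw [mem_dupinIdeal_iff]
  set φ := Ideal.Quotient.mk dupinIdeal
  obtain ⟨⟨k₁, k₂, k₃⟩, ⟨l₁, l₂, l₃⟩, ⟨m₁, m₂, m₃⟩, n₁, n₂, n₃⟩ :=
    generators_eq_zero φ Ideal.mk_ker.ge
  simp only [K₁_eq, K₂_eq, K₃_eq, L₁_eq, L₂_eq, L₃_eq, M₁_eq, M₂_eq, M₃_eq, N₁_eq, N₂_eq, N₃_eq,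
    map_add, map_sub, map_neg, map_mul, map_pow, map_ofNat] at k₁ k₂ k₃ l₁ l₂ l₃ m₁ m₂ m₃ n₁ n₂ n₃
  have ht := congrArg φ t₀_eq
  simp only [map_add, map_sub, map_mul, map_ofNat] at ht
  interval_cases j <;> interval_cases i <;>
    simp only [seqF, seqG, map_sub, map_mul, map_pow, map_ofNat]
  · linear_combination k₃
  · linear_combination -k₂
  · linear_combination -k₁
  -- This is Cayley–Hamilton for `V` applied to `e`: the relations `L` replace `V² e` by `p₀ e`, and
  -- `M` replaces `2 p₀ v` by `q₀ e`.
  · simp only [u₀, t₀, p₀, q₀, W₁, W₂, C₀, E₀, v₁, v₂, v₃, map_add, map_sub, map_neg, map_mul,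
      map_pow, map_ofNat] at l₁ l₂ l₃ m₁ ⊢
    linear_combination 2 * (φ c₁ + φ c₂ + φ c₃) * l₁ - (φ c₂ + φ c₃) * l₁ + φ d₃ * l₂ + φ d₂ * l₃
      - m₁
  · simp only [u₀, t₀, p₀, q₀, W₁, W₂, C₀, E₀, v₁, v₂, v₃, map_add, map_sub, map_neg, map_mul,
      map_pow, map_ofNat] at l₁ l₂ l₃ m₂ ⊢
    linear_combination 2 * (φ c₁ + φ c₂ + φ c₃) * l₂ + φ d₃ * l₁ - (φ c₁ + φ c₃) * l₂ + φ d₁ * l₃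
      - m₂
  · simp only [u₀, t₀, p₀, q₀, W₁, W₂, C₀, E₀, v₁, v₂, v₃, map_add, map_sub, map_neg, map_mul,
      map_pow, map_ofNat] at l₁ l₂ l₃ m₃ ⊢
    linear_combination 2 * (φ c₁ + φ c₂ + φ c₃) * l₃ + φ d₂ * l₁ + φ d₁ * l₂ - (φ c₁ + φ c₂) * l₃
      - m₃
  · linear_combination m₁
  · linear_combination m₂
  · linear_combination m₃
  · linear_combination n₂
  · have hv := congrArg φ v₁.eq_1
    simp only [map_sub, map_add, map_mul] at hv
    linear_combination 2 * φ p₀ * l₁ - (φ c₂ + φ c₃) * m₁ + φ d₃ * m₂ + φ d₂ * m₃ - φ q₀ * hv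
  · have hv := congrArg φ v₂.eq_1
    simp only [map_sub, map_add, map_mul, map_neg] at hv
    linear_combination 2 * φ p₀ * l₂ + φ d₃ * m₁ - (φ c₁ + φ c₃) * m₂ + φ d₁ * m₃ - φ q₀ * hv
  · have hv := congrArg φ v₃.eq_1
    simp only [map_sub, map_add, map_mul, map_neg] at hv
    linear_combination 2 * φ p₀ * l₃ + φ d₂ * m₁ + φ d₁ * m₂ - (φ c₁ + φ c₂) * m₃ - φ q₀ * hv
  · linear_combination 2 * φ p₀ * n₁ + 2 * n₃ - φ q₀ * ht
      + 4 * (φ e₁ * m₁ + φ e₂ * m₂ + φ e₃ * m₃)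
  · linear_combination -n₃

theorem sum_seq_mem (x₀ x₁ x₂ x₃ x₄ x₅ : R4)
    (h : x₀ * e₁ + x₁ * e₂ + x₂ * e₃ + x₃ * u₀ + x₄ * (2 * p₀) + x₅ * q₀ = 0) :
    x₀ * v₁ + x₁ * v₂ + x₂ * v₃ + x₃ * t₀ + x₄ * q₀ + x₅ * (2 * p₀ ^ 2) ∈ dupinIdeal := by
  let x : ℕ → R4 := fun n => match n with
    | 0 => x₀ | 1 => x₁ | 2 => x₂ | 3 => x₃ | 4 => x₄ | _ => x₅
  simpa [Finset.sum_range_succ, seqF, seqG, x] using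
    sum_mul_mem_of_regular dupinIdeal seqF seqG 6 koszul_mem seqF_regular x
      (by simpa [Finset.sum_range_succ, seqF, x] using h)

/-! ### Elimination -/

/-- The ring obtained from `R4` by adjoining a square root of `p₀`. -/
abbrev SqrtExt : Type := QuadraticAlgebra R4 p₀ 0

/-- The remaining relations between the coefficients and `A₂ + A₃`. -/
def sumIdeal : Ideal SqrtExt :=
  Ideal.span {⟨-v₁, e₁⟩, ⟨-v₂, e₂⟩, ⟨-v₃, e₃⟩, ⟨-t₀, u₀⟩, ⟨-q₀, 2 * p₀⟩}

theorem comap_sumIdeal_le : sumIdeal.comap (algebraMap R4 SqrtExt) ≤ dupinIdeal := by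
  intro p hp
  rw [Ideal.mem_comap, sumIdeal] at hp
  simp only [Ideal.mem_span_insert, Ideal.mem_span_singleton'] at hp
  obtain ⟨a, _, ⟨b, _, ⟨c, _, ⟨d, _, ⟨e, rfl⟩, rfl⟩, rfl⟩, rfl⟩, h⟩ := hp
  have hre := congrArg QuadraticAlgebra.re h
  have him := congrArg QuadraticAlgebra.im h
  simp only [QuadraticAlgebra.algebraMap_re, QuadraticAlgebra.algebraMap_im,
    QuadraticAlgebra.re_add, QuadraticAlgebra.im_add, QuadraticAlgebra.re_mul,
    QuadraticAlgebra.im_mul, zero_mul, add_zero] at hre him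
  -- The coefficients come from substituting `v = V e` and `t₀_eq` in the `B`-part, then collecting
  -- the multiples of `e₁, e₂, e₃, u₀, 2p₀, q₀`.
  have key := sum_seq_mem
    (a.re - ((c₂ + c₃) * a.im - d₃ * b.im - d₂ * c.im) + 4 * d.im * e₁)
    (b.re - (-d₃ * a.im + (c₁ + c₃) * b.im - d₁ * c.im) + 4 * d.im * e₂)
    (c.re - (-d₂ * a.im - d₁ * b.im + (c₁ + c₂) * c.im) + 4 * d.im * e₃)
    d.re (e.re - 2 * C₀ * d.im) (2 * d.im - e.im) (by
      rw [t₀_eq, v₁, v₂, v₃] at him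
      linear_combination -him)
  rw [mem_dupinIdeal_iff] at key ⊢
  set φ := Ideal.Quotient.mk dupinIdeal
  obtain ⟨-, ⟨l₁, l₂, l₃⟩, -, n₁, -, -⟩ := generators_eq_zero φ Ideal.mk_ker.ge
  rw [hre]
  simp only [L₁_eq, L₂_eq, L₃_eq, N₁_eq, map_add, map_sub, map_neg, map_mul, map_pow,
    map_ofNat] at key l₁ l₂ l₃ n₁ ⊢
  linear_combination -key + φ a.im * l₁ + φ b.im * l₂ + φ c.im * l₃ + φ d.im * n₁

/-- A solution of the relations over `S` extends `φ` to a map on `R4Ext` that kills all of them. -/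
theorem I4star_le_ker_of_canonical {S : Type*} [CommRing S] [Algebra ℝ S] (φ : R4 →ₐ[ℝ] S)
    (a₁ a₂ a₃ δ : S) (hC : a₁ + a₂ + a₃ = φ C₀) (hW₁ : a₁ * a₂ + a₁ * a₃ + a₂ * a₃ = φ W₁)
    (hW₂ : a₁ * a₂ * a₃ = φ W₂) (h₁ : a₁ * φ e₁ = φ (c₁ * e₁ + d₃ * e₂ + d₂ * e₃))
    (h₂ : a₁ * φ e₂ = φ (d₃ * e₁ + c₂ * e₂ + d₁ * e₃))
    (h₃ : a₁ * φ e₃ = φ (d₂ * e₁ + d₁ * e₂ + c₃ * e₃))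
    (hδ : δ ^ 2 = 4 * φ E₀) (hD : δ ^ 2 = -(a₂ + a₃) * (a₁ - a₂) * (a₁ - a₃))
    (hF : 4 * φ f₀ = a₂ ^ 2 + a₃ ^ 2 + a₂ * a₃ - a₁ * a₂ - a₁ * a₃) :
    I4star ≤ RingHom.ker φ := by
  let ψ : R4Ext →ₐ[ℝ] S := aeval (Sum.elim (fun i => φ (X i)) fun
    | Canon.A i => ![a₁, a₂, a₃] i
    | Canon.D => δ
    | Canon.F => φ f₀)
  have hψ : ∀ x, ψ (incl x) = φ x := by
    intro x
    have : ψ.comp incl = φ := by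
      refine algHom_ext fun i => ?_
      simp [ψ, incl]
    exact DFunLike.congr_fun this x
  have hA₁ : ψ A₁ = a₁ := by simp [ψ, A₁]
  have hA₂ : ψ A₂ = a₂ := by simp [ψ, A₂]
  have hA₃ : ψ A₃ = a₃ := by simp [ψ, A₃]
  have hDδ : ψ D = δ := by simp [ψ, D]
  have hFf : ψ F = φ f₀ := by simp [ψ, F]
  have hle : Ideal.span (canonicalRelations ∪ orthogonalRelations) ≤ RingHom.ker ψ := by
    rw [Ideal.span_le]
    rintro x ((rfl | rfl) | (rfl | rfl | rfl | rfl | rfl | rfl | rfl | rfl)) <;>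
      simp only [SetLike.mem_coe, RingHom.mem_ker, map_sub ψ, map_add ψ, map_mul ψ, map_pow ψ,
        map_neg ψ, map_ofNat ψ, hψ, hA₁, hA₂, hA₃, hDδ, hFf, sub_eq_zero]
    exacts [hD, hF, hC, hW₁, hW₂, h₁, h₂, h₃, hδ]
  intro x hx
  have := hle hx
  rwa [RingHom.mem_ker, hψ] at this

theorem exists_root_quadratic.{u} {S : Type u} [CommRing S] [Algebra ℝ S] (a b : S) :
    ∃ (T : Type u) (_ : CommRing T) (_ : Algebra ℝ T) (ι : S →ₐ[ℝ] T) (ω : T),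
      Function.Injective ι ∧ ω ^ 2 = ι a + ι b * ω := by
  refine ⟨QuadraticAlgebra S a b, inferInstance, inferInstance,
    IsScalarTower.toAlgHom ℝ S _, ⟨0, 1⟩, QuadraticAlgebra.algebraMap_injective, ?_⟩
  ext <;> simp [sq]

theorem I4star_le_ker {S : Type*} [CommRing S] [Algebra ℝ S] (φ : R4 →ₐ[ℝ] S) (B : S)
    (hp : B ^ 2 = φ p₀) (hq : 2 * φ p₀ * B = φ q₀) (hu : φ u₀ * B = φ t₀)
    (h₁ : φ e₁ * B = φ v₁) (h₂ : φ e₂ * B = φ v₂) (h₃ : φ e₃ * B = φ v₃) :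
    I4star ≤ RingHom.ker φ := by
  -- The solution is `A₁ = C₀ - B`, `A₂ = ω`, `A₃ = B - ω`, `D = δ`: the product `A₂ A₃` must be `W₁
  -- - A₁ B`, and `δ² = 4 E₀`.
  obtain ⟨T, _, _, ι₁, ω₁, hι₁, hω₁⟩ := exists_root_quadratic (-(φ W₁ - (φ C₀ - B) * B)) B
  obtain ⟨T', _, _, ι₂, δ, hι₂, hδ⟩ := exists_root_quadratic (ι₁ (4 * φ E₀)) 0
  have hι : Function.Injective (ι₂.comp ι₁) := hι₂.comp hι₁
  obtain ⟨ω, hω⟩ : ∃ ω, ω ^ 2 = (ι₂.comp ι₁) (-(φ W₁ - (φ C₀ - B) * B)) + (ι₂.comp ι₁) B * ω :=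
    ⟨ι₂ ω₁, by rw [← map_pow, hω₁, map_add, map_mul]; rfl⟩
  replace hδ : δ ^ 2 = (ι₂.comp ι₁) (4 * φ E₀) := by
    rw [hδ, map_zero, zero_mul, add_zero]; rfl
  generalize ι₂.comp ι₁ = ι at hι hω hδ
  have hC := congrArg φ C₀.eq_1
  apply_fun ι at hp hq hu h₁ h₂ h₃ hC
  simp only [p₀, q₀, u₀, t₀, v₁, v₂, v₃, map_add, map_sub, map_neg, map_mul, map_pow,
    map_ofNat] at hp hq hu h₁ h₂ h₃ hC hω hδ
  have key : I4star ≤ RingHom.ker (ι.comp φ) := by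
    apply I4star_le_ker_of_canonical (ι.comp φ) (ι (φ C₀ - B)) ω (ι B - ω) δ <;>
      simp only [AlgHom.comp_apply, map_add, map_sub, map_mul]
    · ring
    · linear_combination -hω
    · linear_combination -(ι (φ C₀) - ι B) * hω + (2 * ι (φ C₀) - ι B) * hp - hq - hu
    · linear_combination -h₁ + ι (φ e₁) * hC
    · linear_combination -h₂ + ι (φ e₂) * hC
    · linear_combination -h₃ + ι (φ e₃) * hC
    · exact hδ
    · linear_combination hδ - ι B * hω + hu + 2 * hq + (3 * ι B - 4 * ι (φ C₀)) * hp
    · linear_combination -hω - hp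
  intro x hx
  have := key hx
  rw [RingHom.mem_ker, AlgHom.comp_apply] at this
  exact hι (this.trans (map_zero ι).symm)

theorem I4star_le_dupinIdeal : I4star ≤ dupinIdeal := by
  -- In this quotient the class of `⟨0, 1⟩` serves as `B`, and the kernel of `φ` is the contraction
  -- of `sumIdeal`.
  let φ : R4 →ₐ[ℝ] SqrtExt ⧸ sumIdeal :=
    (Ideal.Quotient.mkₐ ℝ sumIdeal).comp (IsScalarTower.toAlgHom ℝ R4 SqrtExt)
  have hrel : ∀ a b : R4, (⟨-b, a⟩ : SqrtExt) ∈ sumIdeal →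
      φ a * Ideal.Quotient.mk sumIdeal ⟨0, 1⟩ = φ b := by
    intro a b hab
    have h : φ a * Ideal.Quotient.mk sumIdeal ⟨0, 1⟩ - φ b
        = Ideal.Quotient.mk sumIdeal
          (algebraMap R4 SqrtExt a * ⟨0, 1⟩ - algebraMap R4 SqrtExt b) := by
      simp [φ]
    rw [← sub_eq_zero, h, Ideal.Quotient.eq_zero_iff_mem]
    convert hab using 1
    ext <;> simp
  have hker : I4star ≤ RingHom.ker φ := by
    have h2 : (2 : SqrtExt ⧸ sumIdeal) = φ 2 := (map_ofNat φ 2).symm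
    refine I4star_le_ker φ (Ideal.Quotient.mk sumIdeal ⟨0, 1⟩) ?_ ?_ ?_ ?_ ?_ ?_
    · have : (⟨0, 1⟩ : SqrtExt) ^ 2 = algebraMap R4 SqrtExt p₀ := by
        ext <;> simp [sq]
      rw [← map_pow, this]
      rfl
    · rw [h2, ← map_mul]
      exact hrel _ _ (Ideal.subset_span (by simp))
    all_goals exact hrel _ _ (Ideal.subset_span (by simp))
  intro x hx
  exact comap_sumIdeal_le (Ideal.Quotient.eq_zero_iff_mem (I := sumIdeal).1 (hker hx))

end QuarticDupin

end

open QuarticDupin in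
theorem proposition3p4 :
    I4star = Ideal.span {K₁, K₂, K₃, L₁, L₂, L₃, M₁, M₂, M₃, N₁, N₂, N₃} :=
  le_antisymm I4star_le_dupinIdeal dupinIdeal_le_I4star
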